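/- Let $N\ge 1$. Expand the determinant of the $N\times N$ circulant matrix with $(i,j)$ entry $x_{(i-j)\bmod N}$ ($0\le i,j\le N-1$), as $$\det[x_0,\dots,x_{N-1}]=\sum_{0\le a_0\le\cdots\le a_{N-1}\le N-1}C_{a_0\cdots a_{N-1}}\,x_{a_0}\cdots x_{a_{N-1}} ,$$ so that $C_{a_0\cdots a_{N-1}}$ is the coefficient of the monomial $x_{a_0}\cdots x_{a_{N-1}}$ and depends only on the multiset of indices. Consider the index multiset that consists of $M_0$ copies of $0$, $M_1$ copies of $1$, $M_a\ge 0$ copies of an integer $a$ and $M_b\in\{0,1\}$ copies of an integer $b$ (where $b$ may be smaller or larger than $a$), with $M_0+M_1+M_a+M_b=N$ and $M_a+M_b\ge 1$. Here $2\le a\le N-1$ if $M_a>0$, $2\le b\le N-1$ if $M_b>0$, and $a\ne b$ if both are positive. Put $p=N-M_0-M_1-1=M_a+M_b-1$. For $1\le s\le p$ let $X_s$ be the integer with $X_s\equiv -sa \pmod N$ and $0\le X_s\le N-1$. Let $H[n]=1$ for integers $n\ge 0$ and $H[n]=0$ for $n<0$, and for integers $n,k$ let $\binom nk$ be the usual binomial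 coefficient if $0\le k\le n$ and $0$ otherwise (in particular $\binom nk=0$ for $n<0$). If $M_1+aM_a+bM_b\equiv 0 \pmod N$, then $$C_{0\cdots01\cdots1a\cdots ab}=(-1)^{N-M_0-1}\,\frac{N}{M_a+M_b}\binom{M_a+M_b}{M_a}\Biggl\{\binom{N-M_0-1}{M_1}+\sum_{\mu=1}^{p}(-N)^{\mu}\sum_{\substack{\beta_1,\dots,\beta_p\ge 0\\ \beta_1+\cdots+\beta_p=\mu}}H\Bigl[M_1-\sum_{t=1}^p\beta_tX_t\Bigr]\binom{N-M_0-1-\sum_{t=1}^p\beta_t(X_t+t)}{M_1-\sum_{t=1}^p\beta_tX_t}\prod_{s=1}^{p}\frac{1}{s^{\beta_s}\beta_s!}\binom{X_s+s-1}{s-1}^{\beta_s}\Biggr\},$$ and otherwise $C_{0\cdots01\cdots1a\cdots ab}=0$. -/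

import Mathlib

open scoped BigOperators

/-- The determinant `det [x_0, …, x_{N-1}]` of the generic `N × N` circulant matrix, whose first
column is `(x_0, …, x_{N-1})` and whose `(i, j)` entry is `x_{(i - j) mod N}`, as a polynomial
with integer coefficients in the variables `x_0, x_1, …`. -/
noncomputable def circulantDet (N : ℕ) : MvPolynomial ℕ ℤ :=
  (Matrix.circulant (fun i : Fin N => (MvPolynomial.X (i : ℕ) : MvPolynomial ℕ ℤ))).det

/-- `C_{a_0 a_1 ⋯ a_{N-1}}`: the coefficient of the monomial `x_{a_0} x_{a_1} ⋯ x_{a_{N-1}}` in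
the expansion of the circulant determinant. The indices form a multiset `{a_0, …, a_{N-1}}`. -/
noncomputable def circulantCoeff (N : ℕ) (a : Multiset ℕ) : ℤ :=
  MvPolynomial.coeff (Multiset.toFinsupp a) (circulantDet N)

/-- The Heaviside step function `H[n]` on the integers, with `H[0] = 1`. -/
def heavisideStep (n : ℤ) : ℚ := if 0 ≤ n then 1 else 0

/-- The binomial coefficient of two integers: the usual one if `0 ≤ k ≤ n`, and `0` otherwise
(in particular whenever `n` is negative). -/
def intBinom (n k : ℤ) : ℚ := if 0 ≤ k ∧ k ≤ n then (n.toNat.choose k.toNat : ℚ) else 0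

/-- `X_s`: the integer in `[0, N - 1]` that is congruent to `- s a` modulo `N` (for `N ≥ 1`). -/
def negResidue (N a s : ℕ) : ℤ := (-((s : ℤ) * (a : ℤ))) % (N : ℤ)

/-!
The circulant matrix is diagonalised by the Vandermonde matrix of the `N`-th roots of unity, so its
determinant is `∏ f(ω)` over these roots, with `f(z) = ∑ x_j z ^ j` (`map_circulantDet`). The
coefficient is linear in `x_b` if `Mb = 1`; if `Mb = 0`, the derivative in `x_a` reduces to the same
situation with `b = a`, at the price of the factor `Ma = p + 1`. Both cases therefore ask for one
coefficient of `∑ ω ^ b ∏_{ω' ≠ ω} f(ω')`, the derivative of the determinant in `x_b`, at a monomial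
in `x_0`, `x_1` and `x_a` (`add_one_mul_coeff_circulantDet`).

By homogeneity `x_0` may be set to `1` (`coeff_eq_coeff_coeff_specialise`). With `x = x_1`,
`y = x_a` and `u_ω = 1 + ω x`, the sum becomes `P · ∑ ω ^ b / (u_ω + ω ^ a y)`, where
`P = ∏ (u_ω + ω ^ a y)`. Taking the logarithm,
`P = (∏ u_ω) · exp (∑ σ_t y ^ t)` with `σ_t = (-1) ^ (t - 1) / t · ∑ ω ^ (a t) / u_ω ^ t`. Up to the
power `y ^ p` the exponential may be truncated, and the multinomial theorem expands it as a sum over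
`β` (`coeff_sum_mul_prod_erase`).

It remains to work modulo `x ^ N`, which is enough because `M₁ < N`. There `∏ u_ω = 1 - (-x) ^ N`
is `1`, and since the sum of `ω ^ j` over the roots of unity is `N` or `0`, each `σ_t` is the single
term of exponent `X_t` of its power series (`X_pow_dvd_sum_nthRootsFinset_sub`). The remaining factor
`∑ ω ^ b / (u_ω + ω ^ a y)` supplies the last binomial coefficient and the factor `N`, or vanishes
when the congruence modulo `N` fails (`coeff_prod_mul_sum_nthRootsFinset`).
-/

/-! ### Logarithmic derivatives and truncated exponentials of power series -/

section LogarithmicDerivative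

open PowerSeries Finset

variable {R : Type*} [CommRing R] [Algebra ℚ R]

theorem Derivation.apply_prod {S A ι : Type*} [CommSemiring S] [CommSemiring A] [Algebra S A]
    [DecidableEq ι] (D : Derivation S A A) (s : Finset ι) (f : ι → A) :
    D (∏ i ∈ s, f i) = ∑ i ∈ s, D (f i) * ∏ j ∈ s.erase i, f j := by
  induction s using Finset.induction_on with
  | empty => simp
  | insert a s ha ih =>
    rw [prod_insert ha, D.leibniz, ih, sum_insert ha, erase_insert ha, smul_eq_mul, smul_eq_mul,
      mul_sum, mul_comm (∏ i ∈ s, f i), add_comm]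
    congr 1
    refine sum_congr rfl fun i hi => ?_
    have hai : a ≠ i := fun h => ha (h ▸ hi)
    rw [erase_insert_of_ne hai, prod_insert (fun h => ha (mem_of_mem_erase h))]
    ring

/-- Uniqueness for the differential equation `D' = D W` with initial value `0`, to finite order. -/
theorem PowerSeries.X_pow_succ_dvd_of_X_pow_dvd_derivative_sub {D W : R⟦X⟧} {p : ℕ}
    (h0 : coeff 0 D = 0) (hD : X ^ p ∣ d⁄dX R D - D * W) : X ^ (p + 1) ∣ D := by
  rw [X_pow_dvd_iff] at hD ⊢
  intro n
  induction n using Nat.strong_induction_on with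
  | _ n ih =>
    intro hn
    cases n with
    | zero => exact h0
    | succ n =>
      have h1 := hD n (by omega)
      have h2 : coeff n (D * W) = 0 := by
        rw [coeff_mul]
        refine sum_eq_zero fun x hx => ?_
        have := mem_antidiagonal.mp hx
        rw [ih x.1 (by omega) (by omega), zero_mul]
      rw [map_sub, h2, sub_zero, coeff_derivative] at h1
      have h3 : IsUnit ((n : R) + 1) := by
        have := (IsUnit.mk0 ((n : ℚ) + 1) (by positivity)).map (algebraMap ℚ R)
        simpa using this
      exact (h3.mul_left_eq_zero).mp h1

/-- The exponential series of `L`, cut off after the `p`-th power. -/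
noncomputable def truncExp (p : ℕ) (L : R⟦X⟧) : R⟦X⟧ :=
  ∑ μ ∈ range (p + 1), algebraMap ℚ R⟦X⟧ (1 / μ.factorial) * L ^ μ

/-- The truncated exponential satisfies the differential equation of `exp L` to order `p`: up to sign, the
defect is `L ^ p * L' / p!`. -/
theorem X_pow_dvd_derivative_truncExp_sub (p : ℕ) {L : R⟦X⟧} (hL : X ∣ L) :
    X ^ p ∣ d⁄dX R (truncExp p L) - truncExp p L * d⁄dX R L := by
  have h : d⁄dX R (truncExp p L) =
      (∑ μ ∈ range p, algebraMap ℚ R⟦X⟧ (1 / μ.factorial) * L ^ μ) * d⁄dX R L := by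
    rw [truncExp, map_sum, sum_range_succ', sum_mul]
    have hc : ∀ (q : ℚ) (f : R⟦X⟧), d⁄dX R (algebraMap ℚ R⟦X⟧ q * f) =
        algebraMap ℚ R⟦X⟧ q * d⁄dX R f := by
      intro q f
      have : algebraMap ℚ R⟦X⟧ q = C (algebraMap ℚ R q) :=
        IsScalarTower.algebraMap_apply ℚ R R⟦X⟧ q
      rw [this, Derivation.leibniz, derivative_C, smul_zero, add_zero, smul_eq_mul]
    simp only [hc]
    simp only [pow_zero, derivative_one, mul_zero, add_zero]
    refine sum_congr rfl fun μ _ => ?_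
    rw [derivative_pow, Nat.add_sub_cancel]
    have : ((μ + 1 : ℕ) : R⟦X⟧) = algebraMap ℚ R⟦X⟧ (μ + 1) := by simp
    rw [this, ← mul_assoc, ← mul_assoc, ← map_mul]
    have hf : 1 / ((μ + 1).factorial : ℚ) * (μ + 1) = 1 / μ.factorial := by
      rw [Nat.factorial_succ]
      push_cast
      field_simp
    rw [hf]
  rw [h, truncExp, sum_range_succ, add_mul, sub_add_cancel_left, dvd_neg]
  exact ((pow_dvd_pow_of_dvd hL p).mul_left _).mul_right _

theorem coeff_zero_truncExp (p : ℕ) {L : R⟦X⟧} (hL : X ∣ L) : coeff 0 (truncExp p L) = 1 := by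
  rw [truncExp, sum_range_succ', map_add, map_sum, sum_eq_zero, zero_add]
  · simp
  · intro μ _
    have : X ^ 1 ∣ algebraMap ℚ R⟦X⟧ (1 / (μ + 1).factorial) * L ^ (μ + 1) := by
      rw [pow_one]
      exact (dvd_pow hL (by omega)).mul_left _
    exact X_pow_dvd_iff.mp this 0 one_pos

/-- The multinomial theorem applied to each power in the truncated exponential of a polynomial. -/
theorem truncExp_eq_sum_piAntidiag (p : ℕ) (s : Finset ℕ) (σ : ℕ → R) :
    truncExp p (∑ t ∈ s, C (σ t) * X ^ t) =
      ∑ μ ∈ range (p + 1), ∑ β ∈ piAntidiag s μ,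
        C (∏ t ∈ s, algebraMap ℚ R (1 / (β t).factorial) * σ t ^ β t) *
          X ^ (∑ t ∈ s, β t * t) := by
  refine sum_congr rfl fun μ _ => ?_
  rw [sum_pow_eq_sum_piAntidiag, mul_sum]
  refine sum_congr rfl fun β hβ => ?_
  have hm : ((Nat.multinomial s β : ℕ) : R⟦X⟧) =
      algebraMap ℚ R⟦X⟧ (Nat.multinomial s β) := by simp
  rw [hm, ← mul_assoc, ← map_mul]
  have hq : (1 / (μ.factorial : ℚ)) * (Nat.multinomial s β) =
      ∏ t ∈ s, 1 / ((β t).factorial : ℚ) := by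
    have h := Nat.multinomial_spec s β
    rw [(mem_piAntidiag.mp hβ).1] at h
    rw [← h, prod_div_distrib, prod_const_one]
    push_cast
    have h1 : (∏ t ∈ s, ((β t).factorial : ℚ)) ≠ 0 :=
      prod_ne_zero_iff.mpr fun t _ => by positivity
    have h2 : (Nat.multinomial s β : ℚ) ≠ 0 := by
      have := Nat.multinomial_pos s β
      positivity
    field_simp
  rw [hq, IsScalarTower.algebraMap_apply ℚ R R⟦X⟧, map_prod, prod_mul_distrib,
    map_mul, map_prod, map_prod, ← prod_pow_eq_pow_sum]
  have : algebraMap R R⟦X⟧ = C := rfl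
  rw [this, mul_assoc, map_prod, ← prod_mul_distrib, ← prod_mul_distrib,
    ← prod_mul_distrib]
  refine prod_congr rfl fun t _ => ?_
  rw [mul_pow, map_pow, ← pow_mul, mul_comm t]

theorem C_add_X_mul_C_mul_mk_eq_one {R : Type*} [CommRing R] {u v : R} (w : R) (h : u * v = 1) :
    (C u + X * C w) * PowerSeries.mk (fun m => (-1) ^ m * w ^ m * v ^ (m + 1)) = 1 := by
  ext n
  rw [add_mul, mul_assoc, map_add, coeff_C_mul, coeff_mk]
  cases n with
  | zero => simp [h]
  | succ n =>
    rw [coeff_succ_X_mul, coeff_C_mul, coeff_mk, coeff_one, if_neg (by omega)]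
    linear_combination ((-1) ^ (n + 1) * w ^ (n + 1) * v ^ (n + 1)) * h

/-- If `v i` is the inverse of `u i`, the sum on the left is `P * ∑ z k / (u k + w k X)` with
`P = ∏ (u i + w i X)`. Modulo `X ^ (p + 1)`, `P` is `∏ u i` times the truncated exponential of its
logarithm, as both satisfy the same differential equation; the coefficients of that logarithm are
power sums in the `w i * v i`. -/
theorem coeff_sum_mul_prod_erase {ι : Type*} [DecidableEq ι] (s : Finset ι) (u v w z : ι → R) (p : ℕ)
    (h : ∀ i ∈ s, u i * v i = 1) :
    coeff p (∑ k ∈ s, C (z k) * ∏ l ∈ s.erase k, (C (u l) + X * C (w l))) =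
      (∏ i ∈ s, u i) * ∑ μ ∈ range (p + 1), ∑ β ∈ piAntidiag (Icc 1 p) μ,
        (∏ t ∈ Icc 1 p, algebraMap ℚ R (1 / (β t).factorial) *
          (algebraMap ℚ R ((-1) ^ (t - 1) / t) * ∑ i ∈ s, w i ^ t * v i ^ t) ^ β t) *
        (if ∑ t ∈ Icc 1 p, β t * t ≤ p then
          (-1) ^ (p - ∑ t ∈ Icc 1 p, β t * t) * ∑ k ∈ s, z k *
            w k ^ (p - ∑ t ∈ Icc 1 p, β t * t) * v k ^ (p - ∑ t ∈ Icc 1 p, β t * t + 1) else 0) := by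
  set B : ι → R⟦X⟧ := fun i => PowerSeries.mk (fun m => (-1) ^ m * w i ^ m * v i ^ (m + 1)) with hB
  set P : R⟦X⟧ := ∏ l ∈ s, (C (u l) + X * C (w l)) with hP
  set σ : ℕ → R := fun t => algebraMap ℚ R ((-1) ^ (t - 1) / t) * ∑ i ∈ s, w i ^ t * v i ^ t with hσ
  set L : R⟦X⟧ := ∑ t ∈ Icc 1 p, C (σ t) * X ^ t with hLdef
  have hL : X ∣ L := dvd_sum fun t ht =>
    (dvd_pow_self X (by have := (mem_Icc.mp ht).1; omega)).mul_left _
  have herase : ∀ k ∈ s, ∏ l ∈ s.erase k, (C (u l) + X * C (w l)) = P * B k := by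
    intro k hk
    rw [hP, ← mul_prod_erase s _ hk, mul_right_comm, C_add_X_mul_C_mul_mk_eq_one _ (h k hk), one_mul]
  -- The logarithmic derivative of `P` is `∑ w k / (u k + w k X)`.
  have hPd : d⁄dX R P = P * ∑ k ∈ s, C (w k) * B k := by
    rw [hP, Derivation.apply_prod, mul_sum]
    refine sum_congr rfl fun k hk => ?_
    rw [herase k hk]
    simp only [map_add, derivative_C, Derivation.leibniz, derivative_X, smul_eq_mul, hP]
    ring
  -- The power sums in `L` are chosen to make its derivative agree with that of `log P` below `X ^ p`.
  have hWL : X ^ p ∣ d⁄dX R L - ∑ k ∈ s, C (w k) * B k := by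
    rw [X_pow_dvd_iff]
    intro m hm
    rw [map_sub, coeff_derivative, hLdef, map_sum, map_sum, sum_eq_single (m + 1)]
    · rw [coeff_C_mul, coeff_X_pow_self, hσ]
      simp only [hB, coeff_C_mul, coeff_mk]
      have h1 : ((m : R) + 1) = algebraMap ℚ R (m + 1) := by simp
      have h2 : (((-1 : R)) ^ m) = algebraMap ℚ R ((-1) ^ m) := by simp
      rw [h1, mul_one, mul_right_comm, ← map_mul, sub_eq_zero, mul_sum]
      refine sum_congr rfl fun k _ => ?_
      rw [h2, Nat.add_sub_cancel]
      have h3 : ((-1 : ℚ) ^ m / ((m + 1 : ℕ) : ℚ) * (m + 1)) = (-1) ^ m := by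
        push_cast
        field_simp
      rw [h3]
      ring
    · intro t _ ht
      rw [coeff_C_mul, coeff_X_pow, if_neg (Ne.symm ht), mul_zero]
    · intro hnot
      exact absurd (mem_Icc.mpr ⟨by omega, by omega⟩) hnot
  have hPE : X ^ (p + 1) ∣ P - C (∏ i ∈ s, u i) * truncExp p L := by
    refine X_pow_succ_dvd_of_X_pow_dvd_derivative_sub (W := ∑ k ∈ s, C (w k) * B k) ?_ ?_
    · rw [map_sub, coeff_C_mul, coeff_zero_truncExp p hL, hP]
      simp [map_prod]
    · have e1 := X_pow_dvd_derivative_truncExp_sub p hL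
      have hd : d⁄dX R (P - C (∏ i ∈ s, u i) * truncExp p L) =
          d⁄dX R P - C (∏ i ∈ s, u i) * d⁄dX R (truncExp p L) := by
        rw [map_sub, Derivation.leibniz, derivative_C, smul_zero, add_zero, smul_eq_mul]
      rw [hd, hPd]
      have : P * (∑ k ∈ s, C (w k) * B k) - C (∏ i ∈ s, u i) * d⁄dX R (truncExp p L) -
          (P - C (∏ i ∈ s, u i) * truncExp p L) * (∑ k ∈ s, C (w k) * B k) =
          (-C (∏ i ∈ s, u i)) * (d⁄dX R (truncExp p L) - truncExp p L * d⁄dX R L) +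
          (-C (∏ i ∈ s, u i) * truncExp p L) * (d⁄dX R L - ∑ k ∈ s, C (w k) * B k) := by
        ring
      rw [this]
      exact (e1.mul_left _).add (hWL.mul_left _)
  have hG : ∑ k ∈ s, C (z k) * ∏ l ∈ s.erase k, (C (u l) + X * C (w l)) =
      P * ∑ k ∈ s, C (z k) * B k := by
    rw [mul_sum]
    refine sum_congr rfl fun k hk => ?_
    rw [herase k hk]
    ring
  have hfin := X_pow_dvd_iff.mp (hPE.mul_right (∑ k ∈ s, C (z k) * B k)) p (by omega)
  rw [sub_mul, map_sub, sub_eq_zero, mul_assoc, coeff_C_mul] at hfin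
  rw [hG, hfin, hLdef, truncExp_eq_sum_piAntidiag, sum_mul, map_sum]
  congr 1
  refine sum_congr rfl fun μ _ => ?_
  rw [sum_mul, map_sum]
  refine sum_congr rfl fun β _ => ?_
  rw [mul_assoc, coeff_C_mul, coeff_X_pow_mul']
  congr 1
  split_ifs with hle
  · rw [map_sum, mul_sum]
    refine sum_congr rfl fun k _ => ?_
    rw [coeff_C_mul, hB, coeff_mk]
    ring
  · rfl

end LogarithmicDerivative

/-! ### Power sums over the roots of unity, modulo `X ^ N` -/

section RootsOfUnity

open PowerSeries Finset
open Polynomial (nthRootsFinset)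

theorem IsPrimitiveRoot.nthRootsFinset_eq_image {K : Type*} [Field K] [DecidableEq K] {ζ : K}
    {N : ℕ} (hN : 0 < N) (hζ : IsPrimitiveRoot ζ N) :
    nthRootsFinset N (1 : K) = (range N).image (ζ ^ ·) := by
  refine (eq_of_subset_of_card_le (image_subset_iff.mpr fun i _ => ?_) ?_).symm
  · rw [Polynomial.mem_nthRootsFinset hN, ← pow_mul, mul_comm, pow_mul, hζ.pow_eq_one, one_pow]
  · rw [hζ.card_nthRootsFinset, card_image_of_injOn, card_range]
    intro i hi j hj h
    exact hζ.pow_inj (mem_range.mp hi) (mem_range.mp hj) h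

theorem sum_nthRootsFinset_pow {N : ℕ} (hN : 0 < N) (j : ℕ) :
    ∑ ω ∈ nthRootsFinset N (1 : ℂ), ω ^ j = if N ∣ j then (N : ℂ) else 0 := by
  classical
  have hζ := Complex.isPrimitiveRoot_exp N hN.ne'
  set ζ := Complex.exp (2 * Real.pi * Complex.I / N)
  rw [hζ.nthRootsFinset_eq_image hN, sum_image
    (fun i hi j hj h => hζ.pow_inj (mem_range.mp hi) (mem_range.mp hj) h)]
  simp_rw [← pow_mul, mul_comm _ j, pow_mul]
  split_ifs with h
  · rw [(hζ.pow_eq_one_iff_dvd j).mpr h]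
    simp
  · have h1 : ζ ^ j - 1 ≠ 0 := fun h0 => h ((hζ.pow_eq_one_iff_dvd j).mp (sub_eq_zero.mp h0))
    refine (mul_eq_zero.mp ?_).resolve_left h1
    rw [mul_geom_sum, ← pow_mul, mul_comm, pow_mul, hζ.pow_eq_one, one_pow, sub_self]

theorem coeff_mk_neg_pow_pow (ω : ℂ) (m n : ℕ) :
    coeff n (PowerSeries.mk (fun n => (-ω) ^ n) ^ (m + 1)) =
      (-ω) ^ n * ((m + n).choose m : ℂ) := by
  have h : PowerSeries.mk (fun n => (-ω) ^ n) = rescale (-ω) (PowerSeries.mk 1) := by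
    ext n
    simp [coeff_rescale]
  rw [h, ← map_pow, mk_one_pow_eq_mk_choose_add, coeff_rescale, coeff_mk]

theorem one_add_C_mul_X_mul_mk_neg_pow (ω : ℂ) :
    (1 + C ω * X) * PowerSeries.mk (fun n => (-ω) ^ n) = 1 := by
  ext n
  rw [add_mul, one_mul, mul_assoc, map_add, coeff_C_mul, coeff_mk, coeff_one]
  cases n with
  | zero => simp
  | succ n =>
    rw [coeff_succ_X_mul, coeff_mk, if_neg (by omega)]
    ring

theorem coeff_sum_nthRootsFinset {N : ℕ} (hN : 0 < N) (e m n : ℕ) :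
    coeff n (∑ ω ∈ nthRootsFinset N (1 : ℂ),
      C (ω ^ e) * PowerSeries.mk (fun n => (-ω) ^ n) ^ (m + 1)) =
      if N ∣ e + n then (N : ℂ) * (-1) ^ n * ((m + n).choose m : ℂ) else 0 := by
  rw [map_sum]
  have : ∀ ω : ℂ, coeff n (C (ω ^ e) * PowerSeries.mk (fun n => (-ω) ^ n) ^ (m + 1)) =
      ω ^ (e + n) * ((-1) ^ n * ((m + n).choose m : ℂ)) := by
    intro ω
    rw [coeff_C_mul, coeff_mk_neg_pow_pow, neg_pow ω, pow_add]
    ring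
  simp only [this]
  rw [← sum_mul, sum_nthRootsFinset_pow hN, ite_mul, zero_mul, mul_assoc]

theorem X_pow_dvd_prod_one_add_C_mul_X_sub_one {N : ℕ} (hN : 0 < N) :
    (X : ℂ⟦X⟧) ^ N ∣ ∏ ω ∈ nthRootsFinset N (1 : ℂ), (1 + C ω * X) - 1 := by
  classical
  have hζ := Complex.isPrimitiveRoot_exp N hN.ne'
  have h := hζ.map_of_injective (f := (C : ℂ →+* ℂ⟦X⟧)) C_injective
  have h2 := h.pow_sub_pow_eq_prod_sub_mul 1 (-X) hN
  have h3 : ∏ ω ∈ nthRootsFinset N (1 : ℂ⟦X⟧), (1 - ω * -X) =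
      ∏ ω ∈ nthRootsFinset N (1 : ℂ), (1 + C ω * X) := by
    refine (prod_bij (fun ω _ => C ω) (fun ω hω => ?_) (fun a _ b _ hab => C_injective hab)
      (fun b hb => ?_) (fun ω _ => ?_)).symm
    · exact Polynomial.map_mem_nthRootsFinset_one hω _
    · have : NeZero N := ⟨hN.ne'⟩
      obtain ⟨i, -, hi⟩ := h.eq_pow_of_pow_eq_one ((Polynomial.mem_nthRootsFinset hN _).mp hb)
      refine ⟨_, ?_, (map_pow C _ i).trans hi⟩
      rw [Polynomial.mem_nthRootsFinset hN, ← pow_mul, mul_comm i N, pow_mul, hζ.pow_eq_one, one_pow]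
    · ring
  rw [← h3, ← h2, one_pow, sub_sub_cancel_left, dvd_neg, neg_pow]
  exact Dvd.intro_left _ rfl

/-- Summation over the roots of unity keeps only the exponents congruent to `-a t` modulo `N`, and
`r` is the only one below `N`. -/
theorem X_pow_dvd_sum_nthRootsFinset_sub {N a t r : ℕ} (hN : 0 < N) (ht : 0 < t) (hr : r < N)
    (hd : N ∣ a * t + r) :
    (X : ℂ⟦X⟧) ^ N ∣ ∑ ω ∈ nthRootsFinset N (1 : ℂ),
        C (ω ^ a) ^ t * PowerSeries.mk (fun n => (-ω) ^ n) ^ t -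
      C ((N : ℂ) * (-1) ^ r * ((r + t - 1).choose (t - 1) : ℂ)) * X ^ r := by
  obtain ⟨m, rfl⟩ : ∃ m, t = m + 1 := ⟨t - 1, by omega⟩
  rw [X_pow_dvd_iff]
  intro n hn
  simp_rw [← map_pow, ← pow_mul]
  rw [map_sub, coeff_sum_nthRootsFinset hN, coeff_C_mul, coeff_X_pow]
  by_cases h : n = r
  · subst h
    rw [if_pos hd, if_pos rfl, Nat.add_sub_cancel, show n + (m + 1) - 1 = m + n by omega]
    ring
  · rw [if_neg, if_neg h, mul_zero, sub_zero]
    intro h2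
    apply h
    have h3 : a * (m + 1) + n ≡ a * (m + 1) + r [MOD N] :=
      (Nat.modEq_zero_iff_dvd.mpr h2).trans (Nat.modEq_zero_iff_dvd.mpr hd).symm
    exact (Nat.ModEq.add_left_cancel' _ h3).eq_of_lt_of_lt hn hr

theorem dvd_prod_pow_sub_prod_pow {A ι : Type*} [CommRing A] (d : A) (s : Finset ι) (c f g : ι → A)
    (β : ι → ℕ) (h : ∀ i ∈ s, d ∣ f i - g i) :
    d ∣ ∏ i ∈ s, c i * f i ^ β i - ∏ i ∈ s, c i * g i ^ β i := by
  rw [← Ideal.mem_span_singleton, ← Ideal.Quotient.eq, map_prod, map_prod]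
  refine prod_congr rfl fun i hi => ?_
  rw [map_mul, map_mul, map_pow, map_pow]
  congr 2
  rw [Ideal.Quotient.eq, Ideal.mem_span_singleton]
  exact h i hi

/-- The contribution of a single `β`. Modulo `X ^ N` the first two factors reduce to a constant times
`X ^ ∑ β_t ξ_t`, so that one coefficient of the last sum survives. Its exponent condition modulo `N`
does not depend on `β`. -/
theorem coeff_prod_mul_sum_nthRootsFinset {N : ℕ} (hN : 0 < N) {a b p M : ℕ} (hM : M < N)
    {ξ : ℕ → ℕ} (hξ : ∀ t, ξ t < N) (hξd : ∀ t, N ∣ a * t + ξ t) (s : Finset ℕ)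
    (hs : ∀ t ∈ s, 0 < t) (β : ℕ → ℕ) (hβ : ∑ t ∈ s, β t * t ≤ p) :
    coeff M ((∏ ω ∈ nthRootsFinset N (1 : ℂ), (1 + C ω * X)) *
      ((∏ t ∈ s, algebraMap ℚ ℂ⟦X⟧ (1 / (β t).factorial) *
          (algebraMap ℚ ℂ⟦X⟧ ((-1) ^ (t - 1) / t) * ∑ ω ∈ nthRootsFinset N (1 : ℂ),
            C (ω ^ a) ^ t * PowerSeries.mk (fun n => (-ω) ^ n) ^ t) ^ β t) *
        ((-1) ^ (p - ∑ t ∈ s, β t * t) * ∑ ω ∈ nthRootsFinset N (1 : ℂ), C (ω ^ b) *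
            C (ω ^ a) ^ (p - ∑ t ∈ s, β t * t) *
            PowerSeries.mk (fun n => (-ω) ^ n) ^ (p - ∑ t ∈ s, β t * t + 1)))) =
      if N ∣ M + a * p + b then
        N * (-1) ^ (M + p) * if ∑ t ∈ s, β t * ξ t ≤ M then
          (((p - ∑ t ∈ s, β t * t + (M - ∑ t ∈ s, β t * ξ t)).choose
            (M - ∑ t ∈ s, β t * ξ t) : ℕ) : ℂ) *
          ∏ t ∈ s, 1 / ((β t).factorial : ℂ) * (-N / t * ((ξ t + t - 1).choose (t - 1) : ℕ)) ^ β t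
        else 0
      else 0 := by
  set m := p - ∑ t ∈ s, β t * t with hm
  set T := ∑ ω ∈ nthRootsFinset N (1 : ℂ), C (ω ^ b) * C (ω ^ a) ^ m *
            PowerSeries.mk (fun n => (-ω) ^ n) ^ (m + 1) with hT
  set σ : ℕ → ℂ⟦X⟧ := fun t => algebraMap ℚ ℂ⟦X⟧ ((-1) ^ (t - 1) / t) *
    ∑ ω ∈ nthRootsFinset N (1 : ℂ), C (ω ^ a) ^ t * PowerSeries.mk (fun n => (-ω) ^ n) ^ t with hσ
  -- `σ t` is congruent to `ρ t * X ^ ξ t` modulo `X ^ N`.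
  set ρ : ℕ → ℂ := fun t => (-1) ^ t * (-1) ^ ξ t *
    (-N / t * ((ξ t + t - 1).choose (t - 1) : ℕ)) with hρ
  have halg : ∀ q : ℚ, algebraMap ℚ ℂ⟦X⟧ q = C (q : ℂ) := fun q => by
    rw [IsScalarTower.algebraMap_apply ℚ ℂ ℂ⟦X⟧]
    rfl
  have h1 : ∀ t ∈ s, (X : ℂ⟦X⟧) ^ N ∣ σ t - C (ρ t) * X ^ ξ t := by
    intro t ht
    have h := (X_pow_dvd_sum_nthRootsFinset_sub hN (hs t ht) (hξ t) (hξd t)).mul_left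
      (algebraMap ℚ ℂ⟦X⟧ ((-1) ^ (t - 1) / t))
    rw [mul_sub] at h
    convert h using 2
    rw [halg, ← mul_assoc, ← map_mul, hρ]
    congr 2
    obtain ⟨k, rfl⟩ : ∃ k, t = k + 1 := ⟨t - 1, by have := hs t ht; omega⟩
    push_cast
    ring
  have h2 := dvd_prod_pow_sub_prod_pow ((X : ℂ⟦X⟧) ^ N) s
    (fun t => algebraMap ℚ ℂ⟦X⟧ (1 / (β t).factorial)) σ (fun t => C (ρ t) * X ^ ξ t) β h1
  set c : ℂ := ∏ t ∈ s, 1 / ((β t).factorial : ℂ) * ρ t ^ β t with hc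
  have h3 : ∏ t ∈ s, algebraMap ℚ ℂ⟦X⟧ (1 / (β t).factorial) * (C (ρ t) * X ^ ξ t) ^ β t =
      C c * X ^ (∑ t ∈ s, β t * ξ t) := by
    rw [hc, map_prod, ← prod_pow_eq_pow_sum, ← prod_mul_distrib]
    refine prod_congr rfl fun t _ => ?_
    rw [halg, mul_pow, ← map_pow, map_mul, ← pow_mul, mul_comm (ξ t), mul_assoc]
    push_cast
    rfl
  rw [h3] at h2
  have h4 : (X : ℂ⟦X⟧) ^ N ∣ (∏ ω ∈ nthRootsFinset N (1 : ℂ), (1 + C ω * X)) *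
      ((∏ t ∈ s, algebraMap ℚ ℂ⟦X⟧ (1 / (β t).factorial) * σ t ^ β t) * ((-1) ^ m * T)) -
      C c * (X ^ (∑ t ∈ s, β t * ξ t) * ((-1) ^ m * T)) := by
    have e := ((X_pow_dvd_prod_one_add_C_mul_X_sub_one hN).mul_right
      ((∏ t ∈ s, algebraMap ℚ ℂ⟦X⟧ (1 / (β t).factorial) * σ t ^ β t) * ((-1) ^ m * T))).add
      (h2.mul_right ((-1) ^ m * T))
    convert e using 1
    ring
  have h5 := X_pow_dvd_iff.mp h4 M hM
  rw [map_sub, sub_eq_zero] at h5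
  rw [h5, coeff_C_mul, coeff_X_pow_mul']
  by_cases hle : ∑ t ∈ s, β t * ξ t ≤ M
  swap
  · simp [hle]
  rw [if_pos hle, if_pos hle]
  have hneg : ((-1 : ℂ⟦X⟧) ^ m) = C ((-1) ^ m) := by simp
  have hT2 : T = ∑ ω ∈ nthRootsFinset N (1 : ℂ), C (ω ^ (b + a * m)) *
            PowerSeries.mk (fun n => (-ω) ^ n) ^ (m + 1) := by
    refine sum_congr rfl fun ω _ => ?_
    rw [← map_pow, ← map_mul, ← pow_mul, ← pow_add]
  rw [hneg, coeff_C_mul, hT2, coeff_sum_nthRootsFinset hN]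
  have hsum : N ∣ a * (∑ t ∈ s, β t * t) + ∑ t ∈ s, β t * ξ t := by
    rw [mul_sum, ← sum_add_distrib]
    refine dvd_sum fun t _ => ?_
    have := (hξd t).mul_left (β t)
    convert this using 1
    ring
  have hiff : N ∣ b + a * m + (M - ∑ t ∈ s, β t * ξ t) ↔ N ∣ M + a * p + b := by
    rw [← Nat.dvd_add_left hsum]
    have e1 : a * p = a * m + a * (∑ t ∈ s, β t * t) := by
      rw [← mul_add]
      congr 1
      omega
    have e2 : b + a * m + (M - ∑ t ∈ s, β t * ξ t) +
        (a * (∑ t ∈ s, β t * t) + ∑ t ∈ s, β t * ξ t) = M + a * p + b := by omega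
    rw [e2]
  by_cases hdiv : N ∣ M + a * p + b
  swap
  · rw [if_neg (hiff.not.mpr hdiv), if_neg hdiv]
    ring
  rw [if_pos (hiff.mpr hdiv), if_pos hdiv]
  have hcs : c = (-1) ^ (∑ t ∈ s, β t * t) * (-1) ^ (∑ t ∈ s, β t * ξ t) *
      ∏ t ∈ s, 1 / ((β t).factorial : ℂ) *
        (-N / t * ((ξ t + t - 1).choose (t - 1) : ℕ)) ^ β t := by
    rw [hc, ← prod_pow_eq_pow_sum, ← prod_pow_eq_pow_sum, ← prod_mul_distrib, ← prod_mul_distrib]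
    refine prod_congr rfl fun t _ => ?_
    rw [hρ, mul_comm (β t) t, mul_comm (β t) (ξ t), pow_mul, pow_mul]
    ring
  rw [hcs]
  have hsign : (-1 : ℂ) ^ (M + p) = (-1) ^ (∑ t ∈ s, β t * t) * (-1) ^ (∑ t ∈ s, β t * ξ t) *
      (-1) ^ m * (-1) ^ (M - ∑ t ∈ s, β t * ξ t) := by
    rw [← pow_add, ← pow_add, ← pow_add]
    congr 1
    omega
  rw [hsign, Nat.choose_symm_add]
  ring

/-- The inner power series variable stands for `x_1`, the outer one for `x_a`; `x_0` is `1`, and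
`ξ t` is the residue of `-a t` modulo `N`. -/
theorem coeff_coeff_sum_mul_prod_erase {N : ℕ} (hN : 0 < N) {a b p M : ℕ} (hM : M < N)
    {ξ : ℕ → ℕ} (hξ : ∀ t, ξ t < N) (hξd : ∀ t, N ∣ a * t + ξ t) :
    coeff M (coeff p (∑ k ∈ nthRootsFinset N (1 : ℂ), C (C (k ^ b)) *
      ∏ l ∈ (nthRootsFinset N (1 : ℂ)).erase k, (C (1 + C l * X) + X * C (C (l ^ a))))) =
      if N ∣ M + a * p + b then
        (N : ℂ) * (-1) ^ (M + p) * ∑ μ ∈ range (p + 1), ∑ β ∈ piAntidiag (Icc 1 p) μ,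
          if ∑ t ∈ Icc 1 p, β t * t ≤ p ∧ ∑ t ∈ Icc 1 p, β t * ξ t ≤ M then
            (((p - ∑ t ∈ Icc 1 p, β t * t + (M - ∑ t ∈ Icc 1 p, β t * ξ t)).choose
              (M - ∑ t ∈ Icc 1 p, β t * ξ t) : ℕ) : ℂ) *
            ∏ t ∈ Icc 1 p, 1 / ((β t).factorial : ℂ) *
              (-N / t * ((ξ t + t - 1).choose (t - 1) : ℕ)) ^ β t
          else 0
      else 0 := by
  rw [coeff_sum_mul_prod_erase (nthRootsFinset N (1 : ℂ)) (fun l => 1 + C l * X)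
    (fun l => PowerSeries.mk (fun n => (-l) ^ n)) (fun l => C (l ^ a)) (fun k => C (k ^ b)) p
    (fun l _ => one_add_C_mul_X_mul_mk_neg_pow l)]
  rw [mul_sum, map_sum]
  have key : ∀ (F : ℕ → (ℕ → ℕ) → ℂ),
      (if N ∣ M + a * p + b then (N : ℂ) * (-1) ^ (M + p) *
        ∑ μ ∈ range (p + 1), ∑ β ∈ piAntidiag (Icc 1 p) μ, F μ β else 0) =
      ∑ μ ∈ range (p + 1), ∑ β ∈ piAntidiag (Icc 1 p) μ,
        if N ∣ M + a * p + b then (N : ℂ) * (-1) ^ (M + p) * F μ β else 0 := by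
    intro F
    split_ifs
    · simp_rw [mul_sum]
    · simp
  rw [key]
  refine sum_congr rfl fun μ _ => ?_
  rw [mul_sum, map_sum]
  refine sum_congr rfl fun β _ => ?_
  by_cases hβ : ∑ t ∈ Icc 1 p, β t * t ≤ p
  · rw [if_pos hβ, coeff_prod_mul_sum_nthRootsFinset hN hM hξ hξd (Icc 1 p)
      (fun t ht => (mem_Icc.mp ht).1) β hβ]
    simp only [hβ, true_and]
  · simp [hβ]

end RootsOfUnity

/-! ### The circulant determinant and the extraction of its coefficients -/

section CirculantDeterminant

open Finset
open Polynomial (nthRootsFinset)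

/-- The linear form `∑ j < N, ω ^ j x_j`; for an `N`-th root of unity `ω` it is an eigenvalue of the
generic circulant matrix. -/
noncomputable def circulantEigenvalue (N : ℕ) (ω : ℂ) : MvPolynomial ℕ ℂ :=
  ∑ j : Fin N, MvPolynomial.C (ω ^ (j : ℕ)) * MvPolynomial.X (j : ℕ)

/-- The rows of the Vandermonde matrix of the `N`-th roots of unity are left eigenvectors of every
circulant matrix. -/
theorem Matrix.det_circulant_eq_prod {A : Type*} [CommRing A] [IsDomain A] {N : ℕ} {ζ : A}
    (hζ : IsPrimitiveRoot ζ N) (v : Fin N → A) :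
    (Matrix.circulant v).det = ∏ k : Fin N, ∑ j : Fin N, (ζ ^ (k : ℕ)) ^ (j : ℕ) * v j := by
  rcases Nat.eq_zero_or_pos N with rfl | hN
  · simp
  have : NeZero N := ⟨hN.ne'⟩
  set V := Matrix.vandermonde (fun k : Fin N => ζ ^ (k : ℕ)) with hV
  have hdet : V.det ≠ 0 := by
    rw [hV, Matrix.det_vandermonde_ne_zero_iff]
    intro i j h
    exact Fin.ext (hζ.pow_inj i.2 j.2 h)
  have hmul : V * Matrix.circulant v =
      Matrix.diagonal (fun k : Fin N => ∑ j : Fin N, (ζ ^ (k : ℕ)) ^ (j : ℕ) * v j) * V := by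
    ext k j
    rw [Matrix.diagonal_mul, Matrix.mul_apply, sum_mul]
    refine Fintype.sum_equiv (Equiv.subRight j) _ _ fun i => ?_
    simp only [hV, Matrix.vandermonde_apply, Matrix.circulant_apply, Equiv.subRight_apply]
    have hone : (ζ ^ (k : ℕ)) ^ N = 1 := by
      rw [← pow_mul, mul_comm, pow_mul, hζ.pow_eq_one, one_pow]
    rw [mul_right_comm, ← pow_add]
    congr 1
    have h : ((i - j : Fin N) : ℕ) + (j : ℕ) ≡ i [MOD N] := by
      have h1 : (((i - j + j : Fin N)) : ℕ) = i := by rw [sub_add_cancel]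
      rw [Fin.val_add] at h1
      rw [Nat.ModEq, h1, Nat.mod_eq_of_lt i.2]
    rw [pow_eq_pow_mod (i : ℕ) hone, pow_eq_pow_mod (_ + _) hone, h]
  have h := congrArg Matrix.det hmul
  rw [Matrix.det_mul, Matrix.det_mul, Matrix.det_diagonal, mul_comm] at h
  exact mul_right_cancel₀ hdet h

theorem map_circulantDet {N : ℕ} (hN : 0 < N) :
    MvPolynomial.map (Int.castRingHom ℂ) (circulantDet N) =
      ∏ ω ∈ nthRootsFinset N (1 : ℂ), circulantEigenvalue N ω := by
  classical
  have hζ := Complex.isPrimitiveRoot_exp N hN.ne'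
  set ζ := Complex.exp (2 * Real.pi * Complex.I / N)
  have hζ' := hζ.map_of_injective (f := (MvPolynomial.C : ℂ →+* MvPolynomial ℕ ℂ))
    (MvPolynomial.C_injective _ _)
  have h1 : MvPolynomial.map (Int.castRingHom ℂ) (circulantDet N) =
      (Matrix.circulant (fun i : Fin N => (MvPolynomial.X (i : ℕ) : MvPolynomial ℕ ℂ))).det := by
    rw [circulantDet, RingHom.map_det]
    congr 1
    ext1 i j
    simp [Matrix.circulant_apply]
  rw [h1, Matrix.det_circulant_eq_prod hζ', hζ.nthRootsFinset_eq_image hN, prod_image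
    (fun i hi j hj h => hζ.pow_inj (mem_range.mp hi) (mem_range.mp hj) h), prod_range]
  refine prod_congr rfl fun k _ => sum_congr rfl fun j _ => ?_
  rw [map_pow, map_pow]

theorem isHomogeneous_circulantEigenvalue (N : ℕ) (ω : ℂ) :
    (circulantEigenvalue N ω).IsHomogeneous 1 :=
  MvPolynomial.IsHomogeneous.sum _ _ _ fun j _ => by
    simpa using (MvPolynomial.isHomogeneous_C ℕ (ω ^ (j : ℕ))).mul
      (MvPolynomial.isHomogeneous_X ℂ (j : ℕ))

theorem pderiv_circulantEigenvalue {N b : ℕ} (hb : b < N) (ω : ℂ) :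
    MvPolynomial.pderiv b (circulantEigenvalue N ω) = MvPolynomial.C (ω ^ b) := by
  rw [circulantEigenvalue, map_sum, sum_eq_single (⟨b, hb⟩ : Fin N)]
  · simp
  · intro j _ hj
    have : (j : ℕ) ≠ b := fun h => hj (Fin.ext h)
    rw [MvPolynomial.pderiv_C_mul, MvPolynomial.pderiv_X_of_ne this, mul_zero]
  · simp

/-- The specialisation `x_0 ↦ 1`, `x_1 ↦ X`, `x_a ↦ Y`, all other variables to `0`, with values in
the power series in `Y` over the power series in `X`. -/
noncomputable def specialise (a : ℕ) :
    MvPolynomial ℕ ℂ →+* PowerSeries (PowerSeries ℂ) :=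
  MvPolynomial.eval₂Hom (PowerSeries.C.comp PowerSeries.C) fun i =>
    if i = 0 then 1 else if i = 1 then PowerSeries.C PowerSeries.X
    else if i = a then PowerSeries.X else 0

theorem specialise_circulantEigenvalue {N a : ℕ} (ha : 2 ≤ a) (haN : a < N) (ω : ℂ) :
    specialise a (circulantEigenvalue N ω) =
      PowerSeries.C (1 + PowerSeries.C ω * PowerSeries.X) +
        PowerSeries.X * PowerSeries.C (PowerSeries.C (ω ^ a)) := by
  rw [circulantEigenvalue, map_sum]
  have h : ∀ j : Fin N, specialise a (MvPolynomial.C (ω ^ (j : ℕ)) * MvPolynomial.X (j : ℕ)) =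
      PowerSeries.C (PowerSeries.C (ω ^ (j : ℕ))) * (if (j : ℕ) = 0 then 1 else
        if (j : ℕ) = 1 then PowerSeries.C PowerSeries.X
        else if (j : ℕ) = a then PowerSeries.X else 0) := by
    intro j
    rw [map_mul, specialise, MvPolynomial.eval₂Hom_X', MvPolynomial.eval₂Hom_C]
    rfl
  simp_rw [h]
  rw [← sum_subset (subset_univ {⟨0, by omega⟩, ⟨1, by omega⟩, ⟨a, haN⟩})]
  · rw [sum_insert (by simp; omega), sum_insert (by simp; omega), sum_singleton]
    have h0 : a ≠ 0 := by omega
    have h1 : a ≠ 1 := by omega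
    simp [h0, h1]
    ring
  · intro j _ hj
    simp only [mem_insert, mem_singleton, not_or, Fin.ext_iff] at hj
    simp [hj.1, hj.2.1, hj.2.2]

/-- A homogeneous polynomial loses no coefficient in `x_0`, `x_1`, `x_a` under `specialise`: the
exponent of `x_0` is recovered from the degree. -/
theorem coeff_eq_coeff_coeff_specialise {a : ℕ} (ha : 2 ≤ a) {M₀ M₁ p : ℕ}
    {Q : MvPolynomial ℕ ℂ} (hQ : Q.IsHomogeneous (M₀ + M₁ + p)) :
    MvPolynomial.coeff (Finsupp.single 0 M₀ + Finsupp.single 1 M₁ + Finsupp.single a p) Q =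
      PowerSeries.coeff M₁ (PowerSeries.coeff p (specialise a Q)) := by
  classical
  set e : ℕ →₀ ℕ := Finsupp.single 0 M₀ + Finsupp.single 1 M₁ + Finsupp.single a p with he
  have h0 : a ≠ 0 := by omega
  have h1 : a ≠ 1 := by omega
  conv_rhs => rw [Q.as_sum, map_sum, map_sum, map_sum]
  -- A monomial of `Q` contributes only if it involves no other variable and agrees with `e` in the
  -- exponents of `x_1` and `x_a`; the degree then forces agreement in that of `x_0`.
  have key : ∀ m ∈ Q.support, PowerSeries.coeff M₁ (PowerSeries.coeff p
      (specialise a (MvPolynomial.monomial m (Q.coeff m)))) = if m = e then Q.coeff m else 0 := by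
    intro m hm
    have hdeg : m.degree = M₀ + M₁ + p := by
      by_contra hne
      exact MvPolynomial.mem_support_iff.mp hm (hQ.coeff_eq_zero hne)
    rw [specialise, MvPolynomial.eval₂Hom_monomial, RingHom.comp_apply,
      PowerSeries.coeff_C_mul, PowerSeries.coeff_C_mul]
    by_cases hsupp : m.support ⊆ {0, 1, a}
    · have hm3 : m = Finsupp.single 0 (m 0) + Finsupp.single 1 (m 1) + Finsupp.single a (m a) := by
        ext i
        simp only [Finsupp.add_apply, Finsupp.single_apply]
        by_cases hi0 : i = 0
        · subst hi0; simp [h0]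
        by_cases hi1 : i = 1
        · subst hi1; simp [h1]
        by_cases hia : i = a
        · subst hia; simp [Ne.symm h0, Ne.symm h1]
        have : m i = 0 := by
          by_contra hne
          have := hsupp (Finsupp.mem_support_iff.mpr hne)
          simp [hi0, hi1, hia] at this
        simp [this, Ne.symm hi0, Ne.symm hi1, Ne.symm hia]
      have hd : m.degree = m 0 + m 1 + m a := by
        conv_lhs => rw [hm3]
        simp [Finsupp.degree_single]
      have hprod : (m.prod fun i k => (if i = 0 then (1 : PowerSeries (PowerSeries ℂ)) else
          if i = 1 then PowerSeries.C PowerSeries.X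
          else if i = a then PowerSeries.X else 0) ^ k) =
          PowerSeries.C (PowerSeries.X ^ (m 1)) * PowerSeries.X ^ (m a) := by
        rw [Finsupp.prod_of_support_subset m hsupp _ (fun i _ => pow_zero _),
          prod_insert (by simp; omega), prod_insert (by simp; omega), prod_singleton]
        simp [h0, h1]
      rw [hprod, PowerSeries.coeff_C_mul, PowerSeries.coeff_X_pow]
      have hiff : m = e ↔ p = m a ∧ M₁ = m 1 := by
        constructor
        · intro h
          rw [h, he]
          simp [h0, h1, Ne.symm h1]
        · rintro ⟨h2, h3⟩
          have h4 : M₀ = m 0 := by omega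
          rw [he, h2, h3, h4, ← hm3]
      by_cases hp : p = m a
      · rw [if_pos hp, mul_one, PowerSeries.coeff_X_pow]
        by_cases hM : M₁ = m 1
        · rw [if_pos hM, if_pos (hiff.mpr ⟨hp, hM⟩), mul_one]
        · rw [if_neg hM, if_neg (fun h => hM (hiff.mp h).2), mul_zero]
      · rw [if_neg hp, if_neg (fun h => hp (hiff.mp h).1), mul_zero, map_zero, mul_zero]
    · obtain ⟨i, hi, hi'⟩ := not_subset.mp hsupp
      simp only [mem_insert, mem_singleton, not_or] at hi'
      have hz : (m.prod fun i k => (if i = 0 then (1 : PowerSeries (PowerSeries ℂ)) else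
          if i = 1 then PowerSeries.C PowerSeries.X
          else if i = a then PowerSeries.X else 0) ^ k) = 0 := by
        refine prod_eq_zero hi ?_
        simp only [hi'.1, hi'.2.1, hi'.2.2, if_false]
        exact zero_pow (Finsupp.mem_support_iff.mp hi)
      rw [hz, map_zero, map_zero, mul_zero, if_neg]
      rintro rfl
      apply Finsupp.mem_support_iff.mp hi
      simp [he, Ne.symm hi'.1, Ne.symm hi'.2.1, Ne.symm hi'.2.2]
  rw [sum_congr rfl key, sum_ite_eq' Q.support e]
  split_ifs with h
  · rfl
  · exact MvPolynomial.notMem_support_iff.mp h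

theorem coeff_pderiv_circulantDet {N M₀ M₁ a b p : ℕ} (hN : M₀ + M₁ + p + 1 = N)
    (ha : 2 ≤ a) (haN : a < N) (hbN : b < N) :
    ((MvPolynomial.coeff (Finsupp.single 0 M₀ + Finsupp.single 1 M₁ + Finsupp.single a p)
      (MvPolynomial.pderiv b (circulantDet N)) : ℤ) : ℂ) =
    PowerSeries.coeff M₁ (PowerSeries.coeff p (∑ k ∈ nthRootsFinset N (1 : ℂ),
      PowerSeries.C (PowerSeries.C (k ^ b)) * ∏ l ∈ (nthRootsFinset N (1 : ℂ)).erase k,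
        (PowerSeries.C (1 + PowerSeries.C l * PowerSeries.X) +
          PowerSeries.X * PowerSeries.C (PowerSeries.C (l ^ a))))) := by
  have hNpos : 0 < N := by omega
  have h1 : MvPolynomial.map (Int.castRingHom ℂ) (MvPolynomial.pderiv b (circulantDet N)) =
      ∑ k ∈ nthRootsFinset N (1 : ℂ), MvPolynomial.C (k ^ b) *
        ∏ l ∈ (nthRootsFinset N (1 : ℂ)).erase k, circulantEigenvalue N l := by
    rw [← MvPolynomial.pderiv_map, map_circulantDet hNpos, Derivation.apply_prod]
    simp_rw [pderiv_circulantEigenvalue hbN]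
  have hhom : (∑ k ∈ nthRootsFinset N (1 : ℂ), MvPolynomial.C (k ^ b) *
        ∏ l ∈ (nthRootsFinset N (1 : ℂ)).erase k, circulantEigenvalue N l).IsHomogeneous
        (M₀ + M₁ + p) := by
    refine MvPolynomial.IsHomogeneous.sum _ _ _ fun k hk => ?_
    have h2 := MvPolynomial.IsHomogeneous.prod ((nthRootsFinset N (1 : ℂ)).erase k)
      (circulantEigenvalue N) (fun _ => 1) (fun l _ => isHomogeneous_circulantEigenvalue N l)
    have h3 := (MvPolynomial.isHomogeneous_C ℕ (k ^ b)).mul h2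
    rw [sum_const, card_erase_of_mem hk,
      (Complex.isPrimitiveRoot_exp N hNpos.ne').card_nthRootsFinset] at h3
    convert h3 using 1
    simp
    omega
  have h4 := coeff_eq_coeff_coeff_specialise ha hhom
  rw [← h1, MvPolynomial.coeff_map] at h4
  rw [← eq_intCast (Int.castRingHom ℂ), h4, h1]
  congr 2
  rw [map_sum]
  refine sum_congr rfl fun k _ => ?_
  rw [map_mul, map_prod]
  simp_rw [specialise_circulantEigenvalue ha haN]
  congr 1
  rw [specialise, MvPolynomial.eval₂Hom_C]
  rfl

end CirculantDeterminant

/-! ### The coefficient formula -/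

section CoefficientFormula

open Finset

/-- The factor of the coefficient that is a sum over `μ` and over the weak compositions `β` of `μ`, the
summand for `μ = 0` being written separately as a binomial coefficient. Here `p` is the degree in
`x_a` of the monomial in the derivative of the determinant. -/
noncomputable def circulantBracket (N M₀ M₁ a p : ℕ) : ℚ :=
  ((N - M₀ - 1).choose M₁ : ℚ) +
    ∑ μ ∈ Finset.Icc 1 p, (-(N : ℚ)) ^ μ *
      ∑ β ∈ Finset.piAntidiag (Finset.Icc 1 p) μ,
        heavisideStep ((M₁ : ℤ) - ∑ t ∈ Finset.Icc 1 p, (β t : ℤ) * negResidue N a t) *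
        intBinom
          ((N : ℤ) - (M₀ : ℤ) - 1 -
            ∑ t ∈ Finset.Icc 1 p, (β t : ℤ) * (negResidue N a t + (t : ℤ)))
          ((M₁ : ℤ) - ∑ t ∈ Finset.Icc 1 p, (β t : ℤ) * negResidue N a t) *
        ∏ s ∈ Finset.Icc 1 p,
          (1 / ((s : ℚ) ^ β s * ((β s).factorial : ℚ))) *
            intBinom (negResidue N a s + (s : ℤ) - 1) ((s : ℤ) - 1) ^ β s

theorem intBinom_natCast (n k : ℕ) : intBinom (n + k) k = ((n + k).choose k : ℚ) := by
  rw [intBinom, if_pos ⟨by omega, by omega⟩]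
  norm_cast

theorem toNat_negResidue {N : ℕ} (hN : 0 < N) (a t : ℕ) :
    ((negResidue N a t).toNat : ℤ) = negResidue N a t :=
  Int.toNat_of_nonneg (Int.emod_nonneg _ (by omega))

theorem toNat_negResidue_lt {N : ℕ} (hN : 0 < N) (a t : ℕ) : (negResidue N a t).toNat < N := by
  have h1 := toNat_negResidue hN a t
  have h2 : negResidue N a t < N := Int.emod_lt_of_pos _ (by omega)
  omega

theorem dvd_mul_add_toNat_negResidue {N : ℕ} (hN : 0 < N) (a t : ℕ) :
    N ∣ a * t + (negResidue N a t).toNat := by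
  have h : (N : ℤ) ∣ ((a * t + (negResidue N a t).toNat : ℕ) : ℤ) := by
    push_cast
    rw [toNat_negResidue hN, negResidue, Int.emod_def]
    exact ⟨-(-((t : ℤ) * a) / N), by ring⟩
  exact_mod_cast h

/-- Each summand in terms of natural numbers: the conventions for the step function and for binomial
coefficients amount to the two inequalities on the right. -/
theorem neg_pow_mul_bracket_term {N M₀ M₁ a p μ : ℕ} (hN : M₀ + M₁ + p + 1 = N) {β : ℕ → ℕ}
    (hβ : β ∈ piAntidiag (Icc 1 p) μ) :
    (-(N : ℚ)) ^ μ *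
      (heavisideStep ((M₁ : ℤ) - ∑ t ∈ Icc 1 p, (β t : ℤ) * negResidue N a t) *
        intBinom
          ((N : ℤ) - (M₀ : ℤ) - 1 - ∑ t ∈ Icc 1 p, (β t : ℤ) * (negResidue N a t + (t : ℤ)))
          ((M₁ : ℤ) - ∑ t ∈ Icc 1 p, (β t : ℤ) * negResidue N a t) *
        ∏ s ∈ Icc 1 p, (1 / ((s : ℚ) ^ β s * ((β s).factorial : ℚ))) *
            intBinom (negResidue N a s + (s : ℤ) - 1) ((s : ℤ) - 1) ^ β s) =
    if ∑ t ∈ Icc 1 p, β t * t ≤ p ∧ ∑ t ∈ Icc 1 p, β t * (negResidue N a t).toNat ≤ M₁ then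
      (((p - ∑ t ∈ Icc 1 p, β t * t + (M₁ - ∑ t ∈ Icc 1 p, β t * (negResidue N a t).toNat)).choose
        (M₁ - ∑ t ∈ Icc 1 p, β t * (negResidue N a t).toNat) : ℕ) : ℚ) *
      ∏ t ∈ Icc 1 p, 1 / ((β t).factorial : ℚ) *
        (-N / t * (((negResidue N a t).toNat + t - 1).choose (t - 1) : ℕ)) ^ β t
    else 0 := by
  have hNpos : 0 < N := by omega
  have hS : ∑ t ∈ Icc 1 p, (β t : ℤ) * negResidue N a t =
      ((∑ t ∈ Icc 1 p, β t * (negResidue N a t).toNat : ℕ) : ℤ) := by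
    push_cast
    refine sum_congr rfl fun t _ => ?_
    rw [← toNat_negResidue hNpos, Int.toNat_natCast]
  have hT : ∑ t ∈ Icc 1 p, (β t : ℤ) * (negResidue N a t + (t : ℤ)) =
      ((∑ t ∈ Icc 1 p, β t * (negResidue N a t).toNat : ℕ) : ℤ) +
        ((∑ t ∈ Icc 1 p, β t * t : ℕ) : ℤ) := by
    simp_rw [mul_add]
    rw [sum_add_distrib, hS]
    push_cast
    rfl
  rw [hT, hS]
  generalize hSn : ∑ t ∈ Icc 1 p, β t * (negResidue N a t).toNat = S
  generalize hTn : ∑ t ∈ Icc 1 p, β t * t = T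
  split_ifs with h
  · obtain ⟨h1, h2⟩ := h
    have e1 : (N : ℤ) - M₀ - 1 - ((S : ℤ) + (T : ℤ)) = ((p - T : ℕ) : ℤ) + ((M₁ - S : ℕ) : ℤ) := by
      omega
    have e2 : (M₁ : ℤ) - S = ((M₁ - S : ℕ) : ℤ) := by omega
    rw [e1, e2, intBinom_natCast, heavisideStep, if_pos (by omega), one_mul, mul_left_comm]
    congr 1
    rw [← (mem_piAntidiag.mp hβ).1, ← prod_pow_eq_pow_sum, ← prod_mul_distrib]
    refine prod_congr rfl fun t ht => ?_
    have ht1 := (mem_Icc.mp ht).1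
    have e3 : negResidue N a t + (t : ℤ) - 1 =
        ((negResidue N a t).toNat : ℤ) + ((t - 1 : ℕ) : ℤ) := by
      rw [toNat_negResidue hNpos]
      omega
    have e4 : (t : ℤ) - 1 = ((t - 1 : ℕ) : ℤ) := by omega
    rw [e3, e4, intBinom_natCast, Nat.add_sub_assoc ht1, mul_pow, div_pow]
    have ht0 : (t : ℚ) ≠ 0 := by
      have : t ≠ 0 := by omega
      exact_mod_cast this
    field_simp
  · have : intBinom ((N : ℤ) - M₀ - 1 - ((S : ℤ) + (T : ℤ))) ((M₁ : ℤ) - S) = 0 := by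
      rw [intBinom, if_neg]
      rintro ⟨h1, h2⟩
      exact h ⟨by omega, by omega⟩
    rw [this]
    ring

theorem coeff_pderiv_circulantDet_eq_bracket {N M₀ M₁ a b p : ℕ} (hN : M₀ + M₁ + p + 1 = N)
    (ha : 2 ≤ a) (haN : a < N) (hbN : b < N) :
    ((MvPolynomial.coeff (Finsupp.single 0 M₀ + Finsupp.single 1 M₁ + Finsupp.single a p)
      (MvPolynomial.pderiv b (circulantDet N)) : ℤ) : ℚ) =
    if N ∣ M₁ + a * p + b then (N : ℚ) * (-1) ^ (M₁ + p) * circulantBracket N M₀ M₁ a p else 0 := by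
  have hNpos : 0 < N := by omega
  apply Rat.cast_injective (α := ℂ)
  rw [Rat.cast_intCast, coeff_pderiv_circulantDet hN ha haN hbN,
    coeff_coeff_sum_mul_prod_erase hNpos (by omega) (toNat_negResidue_lt hNpos a)
      (dvd_mul_add_toNat_negResidue hNpos a)]
  have hbr : circulantBracket N M₀ M₁ a p =
      ∑ μ ∈ range (p + 1), ∑ β ∈ piAntidiag (Icc 1 p) μ,
        if ∑ t ∈ Icc 1 p, β t * t ≤ p ∧ ∑ t ∈ Icc 1 p, β t * (negResidue N a t).toNat ≤ M₁ then
          (((p - ∑ t ∈ Icc 1 p, β t * t +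
            (M₁ - ∑ t ∈ Icc 1 p, β t * (negResidue N a t).toNat)).choose
              (M₁ - ∑ t ∈ Icc 1 p, β t * (negResidue N a t).toNat) : ℕ) : ℚ) *
          ∏ t ∈ Icc 1 p, 1 / ((β t).factorial : ℚ) *
            (-N / t * (((negResidue N a t).toNat + t - 1).choose (t - 1) : ℕ)) ^ β t
        else 0 := by
    rw [circulantBracket, range_eq_Ico, sum_eq_sum_Ico_succ_bot (by omega)]
    congr 1
    · rw [piAntidiag_zero, sum_singleton]
      have : N - M₀ - 1 = p + M₁ := by omega
      simp [this]
    · rw [zero_add, Finset.Ico_add_one_right_eq_Icc]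
      refine sum_congr rfl fun μ _ => ?_
      rw [mul_sum]
      exact sum_congr rfl fun β hβ => neg_pow_mul_bracket_term hN hβ
  rw [hbr]
  push_cast [apply_ite (Rat.cast : ℚ → ℂ)]
  rfl

theorem toFinsupp_replicate (n i : ℕ) :
    Multiset.toFinsupp (Multiset.replicate n i) = Finsupp.single i n := by
  ext j
  rw [Multiset.toFinsupp_apply, Multiset.count_replicate, Finsupp.single_apply]

theorem circulantBracket_zero (N M₀ M₁ a a' : ℕ) :
    circulantBracket N M₀ M₁ a 0 = circulantBracket N M₀ M₁ a' 0 := by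
  simp [circulantBracket]

/-- The exponent of `x_b` in the monomial, which includes the copies of `x_a` if `a = b`, appears as a
factor because the coefficient is read off from the derivative in `x_b`. -/
theorem add_one_mul_coeff_circulantDet {N M₀ M₁ a b p : ℕ} (hN : M₀ + M₁ + p + 1 = N)
    (hb : 2 ≤ b) (hbN : b < N) (ha : 0 < p → 2 ≤ a ∧ a < N) :
    ((MvPolynomial.coeff (Finsupp.single 0 M₀ + Finsupp.single 1 M₁ + Finsupp.single a p +
      Finsupp.single b 1) (circulantDet N) : ℤ) : ℚ) * ((if a = b then p else 0 : ℕ) + 1) =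
    if N ∣ M₁ + a * p + b then (N : ℚ) * (-1) ^ (M₁ + p) * circulantBracket N M₀ M₁ a p else 0 := by
  -- For `p = 0` nothing depends on `a`, which may then be replaced by `b`.
  wlog h : 2 ≤ a ∧ a < N generalizing a
  · obtain rfl : p = 0 := by
      by_contra hp
      exact h (ha (by omega))
    have := this (a := b) (fun _ => ⟨hb, hbN⟩) ⟨hb, hbN⟩
    rw [circulantBracket_zero N M₀ M₁ b a] at this
    simpa using this
  rw [← coeff_pderiv_circulantDet_eq_bracket hN h.1 h.2 hbN, MvPolynomial.coeff_pderiv]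
  have h0 : b ≠ 0 := by omega
  have h1 : b ≠ 1 := by omega
  have : (Finsupp.single 0 M₀ + Finsupp.single 1 M₁ + Finsupp.single a p : ℕ →₀ ℕ) b =
      if a = b then p else 0 := by
    simp [Finsupp.single_apply, Ne.symm h0, Ne.symm h1]
  rw [this]
  push_cast
  rfl

end CoefficientFormula

theorem mainTheorem10 (N M₀ M₁ Ma Mb a b p : ℕ)
    (hN : M₀ + M₁ + Ma + Mb = N) (hp : M₀ + M₁ + p + 1 = N)
    (hMb : Mb = 0 ∨ Mb = 1)
    (ha : 0 < Ma → 2 ≤ a ∧ a < N)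
    (hb : 0 < Mb → 2 ≤ b ∧ b < N)
    (hab : 0 < Ma → 0 < Mb → a ≠ b) :
    (circulantCoeff N
        (Multiset.replicate M₀ 0 + Multiset.replicate M₁ 1 +
          Multiset.replicate Ma a + Multiset.replicate Mb b) : ℚ) =
      if N ∣ M₁ + a * Ma + b * Mb then
        (-1 : ℚ) ^ (N - M₀ - 1) * ((N : ℚ) / ((Ma : ℚ) + (Mb : ℚ))) *
            ((Ma + Mb).choose Ma : ℚ) *
          (((N - M₀ - 1).choose M₁ : ℚ) +
            ∑ μ ∈ Finset.Icc 1 p, (-(N : ℚ)) ^ μ *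
              ∑ β ∈ Finset.piAntidiag (Finset.Icc 1 p) μ,
                heavisideStep ((M₁ : ℤ) - ∑ t ∈ Finset.Icc 1 p, (β t : ℤ) * negResidue N a t) *
                intBinom
                  ((N : ℤ) - (M₀ : ℤ) - 1 -
                    ∑ t ∈ Finset.Icc 1 p, (β t : ℤ) * (negResidue N a t + (t : ℤ)))
                  ((M₁ : ℤ) - ∑ t ∈ Finset.Icc 1 p, (β t : ℤ) * negResidue N a t) *
                ∏ s ∈ Finset.Icc 1 p,
                  (1 / ((s : ℚ) ^ β s * ((β s).factorial : ℚ))) *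
                    intBinom (negResidue N a s + (s : ℤ) - 1) ((s : ℤ) - 1) ^ β s)
      else 0 := by
  change _ = if N ∣ M₁ + a * Ma + b * Mb then (-1 : ℚ) ^ (N - M₀ - 1) *
    ((N : ℚ) / ((Ma : ℚ) + (Mb : ℚ))) * ((Ma + Mb).choose Ma : ℚ) *
      circulantBracket N M₀ M₁ a p else 0
  rw [circulantCoeff, map_add, map_add, map_add, toFinsupp_replicate, toFinsupp_replicate,
    toFinsupp_replicate, toFinsupp_replicate, show N - M₀ - 1 = M₁ + p by omega]
  rcases hMb with rfl | rfl
  -- No copy of `b`: the derivative is taken in `x_a`, with exponent `p + 1`.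
  · obtain rfl : Ma = p + 1 := by omega
    obtain ⟨ha2, haN⟩ := ha (by omega)
    have h := add_one_mul_coeff_circulantDet (a := a) hp ha2 haN (fun _ => ⟨ha2, haN⟩)
    rw [if_pos rfl, add_assoc _ (Finsupp.single a p), ← Finsupp.single_add, add_assoc (M₁ : ℕ),
      ← Nat.mul_succ] at h
    have hpos : (p : ℚ) + 1 ≠ 0 := by positivity
    rw [Finsupp.single_zero, add_zero, mul_zero, add_zero, eq_div_of_mul_eq hpos h, Nat.add_zero,
      Nat.choose_self]
    split_ifs
    · push_cast
      field_simp
      ring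
    · exact zero_div _
  -- One copy of `b`: the derivative in `x_b` has factor `1`.
  · obtain rfl : Ma = p := by omega
    obtain ⟨hb2, hbN⟩ := hb one_pos
    have h := add_one_mul_coeff_circulantDet (a := a) hp hb2 hbN ha
    have hz : (if a = b then Ma else 0) = 0 := by
      rcases Nat.eq_zero_or_pos Ma with h0 | h0
      · simp [h0]
      · rw [if_neg (hab h0 one_pos)]
    rw [hz, Nat.cast_zero, zero_add, mul_one] at h
    rw [h, mul_one, Nat.choose_succ_self_right]
    have hpos : (Ma : ℚ) + 1 ≠ 0 := by positivity
    split_ifs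
    · push_cast
      field_simp
    · rfl
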